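/- **Phase rotation for MIMO-OTFS.** Let $N,M,P,n_t,n_r\ge 1$, let $T,\Delta f>0$, and consider MIMO-OTFS with $n_t$ transmit and $n_r$ receive antennas on the $N\times M$ delay-Doppler grid $\mathbb Z_N\times\mathbb Z_M$. The channel between any two antennas has $P$ paths, with delays $\tau_i=\alpha_i/(M\Delta f)$ and Doppler shifts $\nu_i=\beta_i/(NT)$, $\alpha_i,\beta_i\in\mathbb Z$, such that the pairs $(\beta_i \bmod N,\ \alpha_i \bmod M)$, $1\le i\le P$, are distinct. If antenna $k$ transmits $x'_k[\cdot,\cdot]$, then antenna $l$ receives $$y_l[q,m]=\sum_{k=1}^{n_t}\sum_{i=1}^{P}h_{lk,i}\,e^{-j2\pi\nu_i\tau_i}\,x'_k[(q-\beta_i)_N,(m-\alpha_i)_M]+v_l[q,m],$$ where all gains $h_{lk,i}$ are i.i.d. $\mathcal{CN}(0,1/P)$ and, independently, all noise samples $v_l[q,m]$ are i.i.d. $\mathcal{CN}(0,N_0)$; the SNR is $\gamma=1/N_0$. Let the alphabet $\mathbb A\subset\mathbb C$ be finite with at least two elements, all of them algebraic numbers (e.g. QAM or PSK), and let its elements carry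 distinct labels of $b$ bits. The information vector $x=(x_1,\dots,x_{n_t})$ is uniformly distributed on $\mathbb A^{n_tMN}$, and the vector $x'=(I_{n_t}\otimes\Phi)x$ is transmitted, where $\Phi$ is the $MN\times MN$ diagonal matrix with entries $\phi_q^{(l)}=e^{ja_q^{(l)}}$, $0\le q<N$, $0\le l<M$, with $a_q^{(l)}$ real, algebraic and pairwise distinct and $\phi_q^{(l)}$ transcendental. The receiver knows the channel and uses maximum likelihood detection (ties broken in any measurable way). Then the system achieves diversity order $P\,n_r$: if $P_e(\gamma)$ denotes either the probability that the information vector is detected erroneously or the bit error rate, then $$\lim_{\gamma\to\infty}-\frac{\log P_e(\gamma)}{\log\gamma}=P\,n_r .$$ Moreover $P\,n_r=n_r\cdot\min\operatorname{rank}(\Delta'_k)$, where the minimum is over all pairs of information vectors $x,z$ and all antennas $k$ with $x_k\ne z_k$, and $\Delta'_k$ is the $P\times MN$ matrix whose row $i$ has the entry $(\Phi x_k-\Phi z_k)[(q-\beta_i)_N,(m-\alpha_i)_M]$ at column $(q,m)$. -/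

import Mathlib

open MeasureTheory ProbabilityTheory Filter Topology
open scoped Kronecker NNReal

noncomputable section

namespace OTFS

/-- Positions `[k, l]` of the `N × M` delay-Doppler grid, `k` (Doppler) modulo `N` and
`l` (delay) modulo `M`. Vectors in `ℂ^{MN}` are indexed by this set. -/
abbrev Grid (N M : ℕ) : Type := ZMod N × ZMod M

/-- `P` propagation paths, the `i`-th one with delay `τ i = α i / (M Δf)` and Doppler shift
`ν i = β i / (N T)`, occupying `P` distinct positions of the delay-Doppler grid. -/
structure Paths (P N M : ℕ) where
  /-- sampling interval in time -/
  T : ℝ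
  /-- sampling interval in frequency -/
  Δf : ℝ
  T_pos : 0 < T
  Δf_pos : 0 < Δf
  /-- integer delay taps -/
  α : Fin P → ℤ
  /-- integer Doppler taps -/
  β : Fin P → ℤ
  distinct : Function.Injective fun i => ((β i : ZMod N), (α i : ZMod M))

variable {nt nr P N M b : ℕ}

namespace Paths

/-- Delay of the `i`-th path. -/
def delay (S : Paths P N M) (i : Fin P) : ℝ := S.α i / (M * S.Δf)

/-- Doppler shift of the `i`-th path. -/
def doppler (S : Paths P N M) (i : Fin P) : ℝ := S.β i / (N * S.T)

/-- Displacement on the grid caused by the `i`-th path. -/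
def shift (S : Paths P N M) (i : Fin P) : Grid N M := ((S.β i : ZMod N), (S.α i : ZMod M))

/-- `h'_i = h_i e^{-j 2π ν_i τ_i}`. -/
def effGain (S : Paths P N M) (h : Fin P → ℂ) (i : Fin P) : ℂ :=
  h i * Complex.exp (-(2 * Real.pi * (S.doppler i * S.delay i) : ℝ) * Complex.I)

/-- Equivalent `MN × MN` channel matrix between two antennas: applied to `x`, it gives
`y[k,l] = ∑ i, h'_i x[(k - β_i)_N, (l - α_i)_M]`. -/
def channelMatrix (S : Paths P N M) (h : Fin P → ℂ) : Matrix (Grid N M) (Grid N M) ℂ :=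
  Matrix.of fun p q => ∑ i, if q = p - S.shift i then S.effGain h i else 0

/-- The block matrix `H_MIMO`, whose block `(l, k)` is the channel matrix from the `k`-th transmit
to the `l`-th receive antenna, with path gains `h (l, k, i)`. -/
def mimoMatrix (S : Paths P N M) (h : Fin nr × Fin nt × Fin P → ℂ) :
    Matrix (Fin nr × Grid N M) (Fin nt × Grid N M) ℂ :=
  Matrix.of fun p q => S.channelMatrix (fun i => h (p.1, q.1, i)) p.2 q.2

/-- The `P × MN` symbol matrix of the transmit vector `x`, so that `(H x)ᵀ = h' X`. -/
def symbolMatrix (S : Paths P N M) (x : Grid N M → ℂ) : Matrix (Fin P) (Grid N M) ℂ :=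
  Matrix.of fun i p => x (p - S.shift i)

end Paths

/-- Information vectors: a symbol of the alphabet for every antenna and grid position. -/
abbrev Codeword (nt N M : ℕ) (A : Finset ℂ) : Type := Fin nt × Grid N M → A

/-- The phase rotation matrix `Φ` with diagonal `φ`. -/
def phaseMatrix (φ : Grid N M → ℂ) : Matrix (Grid N M) (Grid N M) ℂ := Matrix.diagonal φ

variable {A : Finset ℂ} [NeZero N] [NeZero M]

/-- The phase rotated MIMO-OTFS transmit vector `(I ⊗ Φ) x`. -/
def rotated (φ : Grid N M → ℂ) (x : Codeword nt N M A) : Fin nt × Grid N M → ℂ :=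
  ((1 : Matrix (Fin nt) (Fin nt) ℂ) ⊗ₖ phaseMatrix φ).mulVec fun p => (x p : ℂ)

/-- The difference `Δ'_k` of the phase rotated symbol matrices that the codewords `x`, `y` produce
at transmit antenna `k`. -/
def diffMatrix (S : Paths P N M) (φ : Grid N M → ℂ) (x y : Codeword nt N M A) (k : Fin nt) :
    Matrix (Fin P) (Grid N M) ℂ :=
  S.symbolMatrix (fun p => rotated φ x (k, p)) - S.symbolMatrix (fun p => rotated φ y (k, p))

/-- The received vector `H_MIMO (I ⊗ Φ) x + v`. -/
def received (S : Paths P N M) (φ : Grid N M → ℂ) (h : Fin nr × Fin nt × Fin P → ℂ)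
    (v : Fin nr × Grid N M → ℂ) (x : Codeword nt N M A) : Fin nr × Grid N M → ℂ :=
  (S.mimoMatrix h).mulVec (rotated φ x) + v

/-- The circularly symmetric complex Gaussian law `𝒞𝒩(0, s)`: real and imaginary part are
independent centred Gaussians of variance `s / 2`. -/
def complexGaussian (s : ℝ≥0) : Measure ℂ :=
  ((gaussianReal 0 (s / 2)).prod (gaussianReal 0 (s / 2))).map fun z => (⟨z.1, z.2⟩ : ℂ)

/-- Joint law of the path gains, i.i.d. `𝒞𝒩(0, 1/P)`, and the independent noise, i.i.d.
`𝒞𝒩(0, N₀)`, at signal-to-noise ratio `γ = 1 / N₀`. -/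
def law (nt nr P N M : ℕ) [NeZero N] [NeZero M] (γ : ℝ) :
    Measure ((Fin nr × Fin nt × Fin P → ℂ) × (Fin nr × Grid N M → ℂ)) :=
  (Measure.pi fun _ => complexGaussian (1 / (P : ℝ≥0))).prod
    (Measure.pi fun _ => complexGaussian (1 / γ).toNNReal)

/-- Likelihood of the codeword `x` given the channel `h` and the received vector `y`: the density
at `y` of the `𝒞𝒩` law with mean `H_MIMO (I ⊗ Φ) x` and variance `N₀` in every coordinate. -/
def likelihood (S : Paths P N M) (φ : Grid N M → ℂ) (N₀ : ℝ) (h : Fin nr × Fin nt × Fin P → ℂ)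
    (y : Fin nr × Grid N M → ℂ) (x : Codeword nt N M A) : ℝ :=
  ∏ p, (Real.pi * N₀)⁻¹ * Real.exp (-‖y p - (S.mimoMatrix h).mulVec (rotated φ x) p‖ ^ 2 / N₀)

/-- A detector with channel state information: it maps the channel and the received vector to a
codeword. -/
abbrev Detector (nt nr P N M : ℕ) (A : Finset ℂ) : Type :=
  (Fin nr × Fin nt × Fin P → ℂ) → (Fin nr × Grid N M → ℂ) → Codeword nt N M A

/-- `D` is a (measurable) maximum likelihood detector for noise variance `N₀`; ties may be broken
in any measurable way. -/
structure IsML (S : Paths P N M) (φ : Grid N M → ℂ) (N₀ : ℝ) (D : Detector nt nr P N M A) :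
    Prop where
  measurable : ∀ x, MeasurableSet {ω : (Fin nr × Fin nt × Fin P → ℂ) × (Fin nr × Grid N M → ℂ) |
    D ω.1 ω.2 = x}
  maximal : ∀ h y (x : Codeword nt N M A), likelihood S φ N₀ h y x ≤ likelihood S φ N₀ h y (D h y)

/-- Probability that the detector `D` decides for `z` when `x` is sent, at SNR `γ`. -/
def decisionProb (S : Paths P N M) (φ : Grid N M → ℂ) (D : Detector nt nr P N M A) (γ : ℝ)
    (x z : Codeword nt N M A) : ℝ :=
  (law nt nr P N M γ).real {ω | D ω.1 (received S φ ω.1 ω.2 x) = z}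

/-- Probability that a uniformly distributed codeword is detected erroneously, at SNR `γ`. -/
def codewordErrorRate (S : Paths P N M) (φ : Grid N M → ℂ) (D : Detector nt nr P N M A) (γ : ℝ) :
    ℝ :=
  (Fintype.card (Codeword nt N M A) : ℝ)⁻¹ *
    ∑ x, ∑ z, if z = x then 0 else decisionProb S φ D γ x z

/-- Number of bits in which the codewords `x` and `z` differ, if `bits` is the labelling of the
alphabet by `b` bits. -/
def bitErrors (bits : A → Fin b → Bool) (x z : Codeword nt N M A) : ℕ :=
  ∑ p, hammingDist (bits (x p)) (bits (z p))

/-- Bit error rate for a uniformly distributed codeword: the expected fraction of the `b nt M N`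
transmitted bits that are detected erroneously, at SNR `γ`. -/
def bitErrorRate (S : Paths P N M) (φ : Grid N M → ℂ) (bits : A → Fin b → Bool)
    (D : Detector nt nr P N M A) (γ : ℝ) : ℝ :=
  (Fintype.card (Codeword nt N M A) : ℝ)⁻¹ *
    ∑ x, ∑ z, (bitErrors bits x z : ℝ) / (b * nt * M * N) * decisionProb S φ D γ x z

/-- An error probability `p`, as a function of the SNR, has (asymptotic) diversity order `d`:
it decays like `γ ^ (-d)` to first order in the exponent as `γ → ∞`. -/
def HasDiversityOrder (p : ℝ → ℝ) (d : ℝ) : Prop :=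
  Tendsto (fun γ => -Real.log (p γ) / Real.log γ) atTop (𝓝 d)

end OTFS

end

/-! Maximum likelihood prefers `z` to the sent `x` only if the noiseless difference `L h`, linear in
the gains `h`, is at most of the order of the noise. If `Δ'_k` has full row rank `P`, then `L` is
injective on the `P * nr` complex gains leaving antenna `k`. With the other gains fixed, `‖L h‖ ≤ t`
confines these gains to a ball of radius `O(t)`, of probability `O(t ^ (2 * P * nr))`. Averaging
over noise of variance `1 / γ` gives `O(γ ^ (-(P * nr)))` (`exists_decisionProb_le`), and a finite
union bound finishes the upper bound.

Full rank is arithmetic. The rows of `Δ'_k` are translates of `u = Φ (x_k - z_k)` by distinct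
shifts, hence independent once no Fourier coefficient of `u` vanishes
(`linearIndependent_translates`). Such a coefficient is a combination of the `e^{j a_p}` with
algebraic coefficients, not all zero, so `lindemannWeierstrass` applies.

For the converse, two codewords differing in one symbol are distinguished by only `P * nr` gains.
With probability at least a constant times `γ ^ (-(P * nr))` these are of noise size and the noise
cancels their contribution (`exists_le_codewordErrorRate`). The bit error rate agrees with the
codeword error rate up to constant factors. -/

section LindemannWeierstrass

open Polynomial

/-! ### Lindemann–Weierstrass: the integral, Galois-invariant case. -/

theorem isIntegral_pow_mul_aeval {K : Type*} [CommRing K] {a : ℤ} {s : K}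
    (has : IsIntegral ℤ ((a : K) * s)) {g : ℤ[X]} {m : ℕ} (hg : g.natDegree ≤ m) :
    IsIntegral ℤ ((a : K) ^ m * aeval s g) := by
  rw [aeval_eq_sum_range, Finset.mul_sum]
  refine IsIntegral.sum _ fun i hi => ?_
  have hi' : i ≤ m := (Nat.lt_succ_iff.mp (Finset.mem_range.mp hi)).trans hg
  have : (a : K) ^ m * g.coeff i • s ^ i
      = ((a ^ (m - i) * g.coeff i : ℤ) : K) * ((a : K) * s) ^ i := by
    conv_lhs => rw [← Nat.sub_add_cancel hi', pow_add]
    push_cast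
    rw [zsmul_eq_mul, mul_pow]
    ring
  rw [this]
  exact (isIntegral_algebraMap (R := ℤ) (A := K)).mul (has.pow i)

/-- The Hermite approximation of `exp` is available only at the roots of an integer polynomial with
nonzero constant term. -/
theorem exists_int_polynomial_common_root {K : Type*} [Field K] [NumberField K] (S : Finset K)
    (hS : (0 : K) ∉ S) : ∃ f : ℤ[X], f.eval 0 ≠ 0 ∧ ∀ s ∈ S, aeval s f = 0 := by
  have h (s : K) (hs : s ∈ S) : ∃ q : ℤ[X], q.coeff 0 ≠ 0 ∧ aeval s q = 0 := by
    have halg : IsAlgebraic ℤ s :=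
      (IsFractionRing.isAlgebraic_iff ℤ ℚ K).mpr (Algebra.IsAlgebraic.isAlgebraic s)
    exact halg.exists_nonzero_coeff_and_aeval_eq_zero
      (mem_nonZeroDivisors_of_ne_zero fun h0 => hS (h0 ▸ hs))
  choose! q hq hqs using h
  refine ⟨∏ s ∈ S, q s, ?_, fun s hs => ?_⟩
  · rw [eval_prod]
    exact Finset.prod_ne_zero_iff.mpr fun s hs => by rw [← coeff_zero_eq_eval_zero]; exact hq s hs
  · rw [map_prod]
    exact Finset.prod_eq_zero hs (hqs s hs)

variable {K : Type*} [Field K] [NumberField K] [IsGalois ℚ K]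

theorem eq_intCast_of_isIntegral_of_fixed {x : K} (hx : IsIntegral ℤ x)
    (hfix : ∀ σ : Gal(K/ℚ), σ x = x) : ∃ z : ℤ, x = z := by
  obtain ⟨q, rfl⟩ := (IsGalois.mem_range_algebraMap_iff_fixed x).mpr hfix
  rw [isIntegral_algebraMap_iff (algebraMap ℚ K).injective] at hx
  obtain ⟨z, rfl⟩ := IsIntegrallyClosed.isIntegral_iff.mp hx
  exact ⟨z, by simp⟩

variable [Algebra K ℂ]

/-- Hermite's method: for a large prime `p`, there are `n` prime to `p` and an integer polynomial
`g` with `n e^s` very close to `p g(s)` on `S`. Substituting into the relation and clearing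
denominators leaves an integer that is nonzero modulo `p` when `c₀ ≠ 0`, yet of absolute value below
1. -/
theorem eq_zero_of_int_add_sum_exp_eq_zero (S : Finset K) (hS0 : (0 : K) ∉ S)
    (hS : ∀ σ : Gal(K/ℚ), ∀ s ∈ S, σ s ∈ S) (c : K → K) (hc : ∀ s ∈ S, IsIntegral ℤ (c s))
    (hcS : ∀ σ : Gal(K/ℚ), ∀ s ∈ S, c (σ s) = σ (c s)) (c₀ : ℤ)
    (h : (c₀ : ℂ) + ∑ s ∈ S, algebraMap K ℂ (c s) * Complex.exp (algebraMap K ℂ s) = 0) :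
    c₀ = 0 := by
  by_contra hc₀
  obtain ⟨f, hf0, hf⟩ := exists_int_polynomial_common_root S hS0
  have hfne : f ≠ 0 := by rintro rfl; simp at hf0
  obtain ⟨a, ha0, ha⟩ := exists_integral_multiples ℤ ℚ S
  obtain ⟨C, hC⟩ := LindemannWeierstrass.exp_polynomial_approx f hf0
  set d := f.natDegree
  set B : ℝ := ∑ s ∈ S, ‖algebraMap K ℂ (c s)‖
  set X : ℝ := ‖(a : ℂ)‖ ^ d * |C|
  have hlim : Tendsto (fun n : ℕ => B * X * (X ^ n / n.factorial)) atTop (𝓝 0) := by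
    simpa using (FloorSemiring.tendsto_pow_div_factorial_atTop X).const_mul (B * X)
  obtain ⟨N, hN⟩ := (hlim.eventually (gt_mem_nhds one_pos)).exists_forall_of_atTop
  -- Beyond `N` for the analytic bound, and beyond `|f(0)|`, `|a|`, `|c₀|`: the approximation then
  -- applies, and `p` divides neither `a` nor `c₀`.
  obtain ⟨p, hpN, hp⟩ := Nat.exists_infinite_primes
    (N + (f.eval 0).natAbs + a.natAbs + c₀.natAbs + 1)
  obtain ⟨n, hpn, g, hgd, hg⟩ := hC p (by omega) hp
  have hpZ : Prime (p : ℤ) := Nat.prime_iff_prime_int.mp hp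
  have hndvd {z : ℤ} (hz : z ≠ 0) (hzp : z.natAbs < p) : ¬ (p : ℤ) ∣ z := fun hd =>
    absurd (Nat.le_of_dvd (Int.natAbs_pos.mpr hz) (Int.natCast_dvd.mp hd)) (by omega)
  -- The factor `a ^ (p * d)` clears denominators since `g` has degree at most `p * d`; the Galois
  -- group only permutes the summands.
  obtain ⟨z, hz⟩ : ∃ z : ℤ, (a : K) ^ (p * d) * ∑ s ∈ S, c s * aeval s g = z := by
    apply eq_intCast_of_isIntegral_of_fixed
    · rw [Finset.mul_sum]
      refine IsIntegral.sum _ fun s hs => ?_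
      rw [mul_left_comm]
      refine (hc s hs).mul (isIntegral_pow_mul_aeval ?_ (hgd.trans (Nat.sub_le _ _)))
      simpa using ha s hs
    · intro σ
      rw [map_mul, map_pow, map_intCast, map_sum]
      congr 1
      refine Finset.sum_nbij' (fun s => σ s) (fun s => σ⁻¹ s) (hS σ) (hS σ⁻¹) ?_ ?_ ?_
      · intro s _; exact σ.symm_apply_apply s
      · intro s _; exact σ.apply_symm_apply s
      · intro s hs
        rw [map_mul, hcS σ s hs]
        congr 1
        exact (aeval_algHom_apply (σ.toAlgHom.restrictScalars ℤ) s g).symm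
  have hzC : (a : ℂ) ^ (p * d) *
      ∑ s ∈ S, algebraMap K ℂ (c s) * aeval (algebraMap K ℂ s) g = z := by
    have := congrArg (algebraMap K ℂ) hz
    simpa [aeval_algebraMap_apply] using this
  have key : ((a ^ (p * d) * n * c₀ + p * z : ℤ) : ℂ) = -((a : ℂ) ^ (p * d) *
      ∑ s ∈ S, algebraMap K ℂ (c s) *
        (n • Complex.exp (algebraMap K ℂ s) - p • aeval (algebraMap K ℂ s) g)) := by
    push_cast
    rw [← hzC]
    have h' : (c₀ : ℂ) = -∑ s ∈ S, algebraMap K ℂ (c s) * Complex.exp (algebraMap K ℂ s) :=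
      eq_neg_of_add_eq_zero_left h
    simp only [h', zsmul_eq_mul, nsmul_eq_mul, Finset.mul_sum, mul_neg]
    rw [← Finset.sum_neg_distrib, ← Finset.sum_add_distrib, ← Finset.sum_neg_distrib]
    exact Finset.sum_congr rfl fun s _ => by ring
  have hne : (a ^ (p * d) * n * c₀ + p * z : ℤ) ≠ 0 := by
    intro h0
    have : (p : ℤ) ∣ a ^ (p * d) * n * c₀ :=
      (dvd_add_left (dvd_mul_right _ z)).mp (h0 ▸ dvd_zero _)
    rcases hpZ.dvd_or_dvd this with h1 | h1
    · rcases hpZ.dvd_or_dvd h1 with h2 | h2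
      · exact hndvd ha0 (by omega) (hpZ.dvd_of_dvd_pow h2)
      · exact hpn h2
    · exact hndvd hc₀ (by omega) h1
  have hone : (1 : ℝ) ≤ ‖((a ^ (p * d) * n * c₀ + p * z : ℤ) : ℂ)‖ := by
    rw [Complex.norm_intCast]
    exact_mod_cast Int.one_le_abs hne
  have hle : ‖((a ^ (p * d) * n * c₀ + p * z : ℤ) : ℂ)‖
      ≤ B * X * (X ^ (p - 1) / (p - 1).factorial) := by
    rw [key, norm_neg, norm_mul, norm_pow]
    have h1 : ‖∑ s ∈ S, algebraMap K ℂ (c s) *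
        (n • Complex.exp (algebraMap K ℂ s) - p • aeval (algebraMap K ℂ s) g)‖
        ≤ B * (|C| ^ p / (p - 1).factorial) := by
      rw [Finset.sum_mul]
      refine norm_sum_le_of_le _ fun s hs => ?_
      rw [norm_mul]
      gcongr
      refine (hg ?_).trans ?_
      · rw [mem_aroots]
        exact ⟨hfne, by rw [aeval_algebraMap_apply, hf s hs, map_zero]⟩
      · rw [← abs_pow]
        exact div_le_div_of_nonneg_right (le_abs_self _) (Nat.cast_nonneg _)
    calc _ ≤ ‖(a : ℂ)‖ ^ (p * d) * (B * (|C| ^ p / (p - 1).factorial)) := by gcongr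
      _ = B * (X ^ p / (p - 1).factorial) := by
        simp only [X, mul_pow, ← pow_mul, mul_comm d p]; ring
      _ = _ := by
        rw [← mul_pow_sub_one hp.ne_zero X]; ring
  have := hN (p - 1) (by omega)
  linarith

end LindemannWeierstrass

/-! ### Reduction of the general case by Galois symmetrization. -/

namespace ExpSum

variable {K : Type*} [Field K] [NumberField K]

/-- The automorphism `c e^s ↦ σ(c) e^{σ(s)}` of formal exponential sums over `K`. -/
noncomputable def galoisMap (σ : Gal(K/ℚ)) : AddMonoidAlgebra K K →+* AddMonoidAlgebra K K :=
  (AddMonoidAlgebra.mapDomainRingHom K (σ : K →+ K)).comp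
    (AddMonoidAlgebra.mapRingHom K (σ : K →+* K))

theorem coeff_galoisMap (σ : Gal(K/ℚ)) (F : AddMonoidAlgebra K K) (s : K) :
    (galoisMap σ F).coeff (σ s) = σ (F.coeff s) :=
  Finsupp.mapDomain_apply σ.injective _ s

theorem galoisMap_single (σ : Gal(K/ℚ)) (s c : K) :
    galoisMap σ (AddMonoidAlgebra.single s c) = AddMonoidAlgebra.single (σ s) (σ c) := by
  simp [galoisMap]

theorem galoisMap_mul (σ τ : Gal(K/ℚ)) (F : AddMonoidAlgebra K K) :
    galoisMap (σ * τ) F = galoisMap σ (galoisMap τ F) := by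
  ext x
  obtain ⟨y, rfl⟩ := σ.surjective x
  obtain ⟨s, rfl⟩ := τ.surjective y
  rw [coeff_galoisMap, coeff_galoisMap]
  exact coeff_galoisMap (σ * τ) F s

theorem galoisMap_one (F : AddMonoidAlgebra K K) : galoisMap 1 F = F := by
  ext x
  exact coeff_galoisMap 1 F x

theorem galoisMap_ne_zero (σ : Gal(K/ℚ)) {F : AddMonoidAlgebra K K} (hF : F ≠ 0) :
    galoisMap σ F ≠ 0 := by
  intro h
  refine hF ?_
  rw [← galoisMap_one F, ← inv_mul_cancel σ, galoisMap_mul, h, map_zero]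

variable [Algebra K ℂ]

/-- Evaluation of a formal exponential sum over `K`. -/
noncomputable def eval : AddMonoidAlgebra K K →ₐ[K] ℂ :=
  AddMonoidAlgebra.lift K ℂ K
    { toFun := fun s => Complex.exp (algebraMap K ℂ s.toAdd)
      map_one' := by simp
      map_mul' := fun s t => by simp [Complex.exp_add] }

theorem eval_eq_sum (F : AddMonoidAlgebra K K) :
    eval F = ∑ s ∈ F.coeff.support, algebraMap K ℂ (F.coeff s) * Complex.exp (algebraMap K ℂ s) := by
  rw [eval, AddMonoidAlgebra.lift_apply, Finsupp.sum]
  exact Finset.sum_congr rfl fun s _ => Algebra.smul_def _ _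

variable [IsGalois ℚ K]

/-- Multiplying by a common denominator `y` makes all coefficients integral, and the constant term
becomes the nonzero integer `y * m`. -/
theorem eval_ne_zero_of_invariant {F : AddMonoidAlgebra K K}
    (hF : ∀ σ : Gal(K/ℚ), galoisMap σ F = F) {m : ℕ} (hm : m ≠ 0) (hF0 : F.coeff 0 = m) :
    eval F ≠ 0 := by
  classical
  intro h
  have hinv (σ : Gal(K/ℚ)) (s : K) : F.coeff (σ s) = σ (F.coeff s) := by
    conv_lhs => rw [← hF σ]
    exact coeff_galoisMap σ F s
  obtain ⟨y, hy0, hy⟩ := exists_integral_multiples ℤ ℚ (F.coeff.support.image F.coeff)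
  have h0 : (0 : K) ∈ F.coeff.support := by simp [hF0, hm]
  have := eq_zero_of_int_add_sum_exp_eq_zero (F.coeff.support.erase 0) (by simp)
    (fun σ s hs => ?_) (fun s => y • F.coeff s)
    (fun s hs => hy _ (Finset.mem_image_of_mem _ (Finset.mem_of_mem_erase hs)))
    (fun σ s _ => ?_) (y * m) ?_
  · simp [hy0, hm] at this
  · simpa [hinv] using hs
  · simp [hinv]
  · rw [eval_eq_sum, ← Finset.add_sum_erase _ _ h0] at h
    simp only [hF0, map_zero, Complex.exp_zero, mul_one, map_natCast] at h
    simp only [zsmul_eq_mul, map_mul, map_intCast, mul_assoc, ← Finset.mul_sum]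
    push_cast
    rw [← mul_add, h, mul_zero]

theorem eval_ne_zero {F : AddMonoidAlgebra K K} (hF : F ≠ 0) : eval F ≠ 0 := by
  intro h
  -- The norm of `F`: it is invariant, still evaluates to zero through the factor `σ = 1`, and is
  -- nonzero because the group algebra has no zero divisors.
  set G : AddMonoidAlgebra K K := ∏ σ : Gal(K/ℚ), galoisMap σ F
  have hG : G ≠ 0 := Finset.prod_ne_zero_iff.mpr fun σ _ => galoisMap_ne_zero σ hF
  have hGinv (σ : Gal(K/ℚ)) : galoisMap σ G = G := by
    simp only [G, map_prod, ← galoisMap_mul]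
    exact Fintype.prod_equiv (Equiv.mulLeft σ) _ _ fun _ => rfl
  have hGeval : eval G = 0 := by
    rw [map_prod]
    exact Finset.prod_eq_zero (Finset.mem_univ 1) (by rw [galoisMap_one, h])
  obtain ⟨s, hs⟩ : ∃ s, G.coeff s ≠ 0 := by
    by_contra! hall
    exact hG (by ext s; simpa using hall s)
  -- Invariance gives `G` the coefficient `σ (G.coeff s)` at `σ s`, so each summand of `H`
  -- contributes exactly 1 to the constant term of `G * H`.
  set H : AddMonoidAlgebra K K :=
    ∑ σ : Gal(K/ℚ), AddMonoidAlgebra.single (-σ s) (σ (G.coeff s)⁻¹)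
  have hHinv (σ : Gal(K/ℚ)) : galoisMap σ H = H := by
    simp only [H, map_sum, galoisMap_single]
    exact Fintype.sum_equiv (Equiv.mulLeft σ) _ _ fun τ => by simp
  have hcoeff : (G * H).coeff 0 = Fintype.card Gal(K/ℚ) := by
    have hterm (σ : Gal(K/ℚ)) :
        (G * AddMonoidAlgebra.single (-σ s) (σ (G.coeff s)⁻¹)).coeff 0 = 1 := by
      rw [AddMonoidAlgebra.coeff_mul_single_eq_coeff_mul (σ s)
        (fun x _ => by rw [add_neg_eq_zero])]
      have : G.coeff (σ s) = σ (G.coeff s) := by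
        conv_lhs => rw [← hGinv σ]
        exact coeff_galoisMap σ G s
      rw [this, ← map_mul, mul_inv_cancel₀ hs, map_one]
    simp only [H, Finset.mul_sum, AddMonoidAlgebra.coeff_sum, Finsupp.finsetSum_apply, hterm,
      Finset.sum_const, nsmul_eq_mul, mul_one, Finset.card_univ]
  refine eval_ne_zero_of_invariant (F := G * H) (fun σ => ?_) Fintype.card_ne_zero hcoeff ?_
  · rw [map_mul, hGinv, hHinv]
  · rw [map_mul, hGeval, zero_mul]

end ExpSum

/-- The **Lindemann–Weierstrass theorem**: exponentials of distinct algebraic numbers are linearly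
independent over the algebraic numbers. -/
theorem lindemannWeierstrass {ι : Type*} [Fintype ι] {a c : ι → ℂ} (ha : Function.Injective a)
    (haalg : ∀ i, IsAlgebraic ℚ (a i)) (hcalg : ∀ i, IsAlgebraic ℚ (c i))
    (h : ∑ i, c i * Complex.exp (a i) = 0) (i : ι) : c i = 0 := by
  set T : Set ℂ := Set.range a ∪ Set.range c
  have hT : ∀ x ∈ T, IsIntegral ℚ x := by
    rintro x (⟨i, rfl⟩ | ⟨i, rfl⟩)
    exacts [(haalg i).isIntegral, (hcalg i).isIntegral]
  set E := IntermediateField.adjoin ℚ T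
  have : FiniteDimensional ℚ E := IntermediateField.finiteDimensional_adjoin hT
  -- The normal closure is taken inside `ℂ`, so that the field is Galois over `ℚ` and keeps its
  -- embedding.
  set K := IntermediateField.normalClosure ℚ E ℂ
  have : FiniteDimensional ℚ K := normalClosure.is_finiteDimensional ℚ E ℂ
  have : NumberField K := ⟨⟩
  have : Normal ℚ K := (Algebra.IsAlgebraic.isNormalClosure_normalClosure
    fun x : E => IsAlgClosed.splits _).normal
  have : IsGalois ℚ K := ⟨⟩
  have hTK : T ⊆ K := (IntermediateField.subset_adjoin ℚ T).trans E.le_normalClosure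
  let a' (i : ι) : K := ⟨a i, hTK (Or.inl ⟨i, rfl⟩)⟩
  let c' (i : ι) : K := ⟨c i, hTK (Or.inr ⟨i, rfl⟩)⟩
  have ha' : Function.Injective a' := fun i j hij => ha (congrArg Subtype.val hij)
  set F : AddMonoidAlgebra K K := ∑ i, AddMonoidAlgebra.single (a' i) (c' i)
  have hF : F = 0 := by
    by_contra hF
    refine ExpSum.eval_ne_zero hF ?_
    rw [map_sum, ← h]
    exact Finset.sum_congr rfl fun i _ => by
      rw [ExpSum.eval, AddMonoidAlgebra.lift_single, Algebra.smul_def]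
      rfl
  have : c' i = F.coeff (a' i) := by
    classical
    simp [F, AddMonoidAlgebra.coeff_sum, Finsupp.single_apply, ha'.eq_iff]
  rw [hF] at this
  exact congrArg Subtype.val this

/-! ### Full rank of the difference matrices. -/

theorem AddChar.isAlgebraic_apply {G : Type*} [AddCommGroup G] [Fintype G] (χ : AddChar G ℂ)
    (g : G) : IsAlgebraic ℚ (χ g) := by
  refine IsIntegral.isAlgebraic (IsIntegral.of_pow (n := Fintype.card G) Fintype.card_pos ?_)
  rw [← AddChar.map_nsmul_eq_pow, card_nsmul_eq_zero, AddChar.map_zero_eq_one]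
  exact isIntegral_one

/-- Translates of a function on a finite abelian group without zero Fourier coefficients are
linearly independent. -/
theorem linearIndependent_translates {G ι : Type*} [AddCommGroup G] [Fintype G] [Finite ι]
    {u : G → ℂ} (hu : ∀ χ : AddChar G ℂ, ∑ g, χ g * u g ≠ 0) {s : ι → G}
    (hs : Function.Injective s) : LinearIndependent ℂ fun i g => u (g - s i) := by
  classical
  cases nonempty_fintype ι
  rw [Fintype.linearIndependent_iff]
  intro c hc
  -- Translation by `s i` multiplies the Fourier coefficient at `χ` by `χ (s i)`; the common factor,
  -- the coefficient of `u`, cancels.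
  have hchar (χ : AddChar G ℂ) : ∑ i, c i * χ (s i) = 0 := by
    refine (mul_eq_zero.mp ?_).resolve_right (hu χ)
    have hshift (i : ι) : χ (s i) * ∑ g, χ g * u g = ∑ g, χ g * u (g - s i) := by
      rw [Finset.mul_sum]
      refine Fintype.sum_equiv (Equiv.addRight (s i)) _ _ fun g => ?_
      simp [AddChar.map_add_eq_mul]
      ring
    calc (∑ i, c i * χ (s i)) * ∑ g, χ g * u g
        = ∑ i, ∑ g, χ g * (c i * u (g - s i)) := by
          rw [Finset.sum_mul]
          refine Finset.sum_congr rfl fun i _ => ?_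
          rw [mul_assoc, hshift, Finset.mul_sum]
          exact Finset.sum_congr rfl fun g _ => by ring
      _ = ∑ g, χ g * ∑ i, c i * u (g - s i) := by
          rw [Finset.sum_comm]
          simp only [Finset.mul_sum]
      _ = 0 := Finset.sum_eq_zero fun g _ => by
          have := congrFun hc g
          simp only [Finset.sum_apply, Pi.smul_apply, smul_eq_mul, Pi.zero_apply] at this
          rw [this, mul_zero]
  intro j
  -- Orthogonality of characters isolates `c j`, as the `s i` are distinct.
  have hsum : ∑ χ : AddChar G ℂ, χ (-s j) * ∑ i, c i * χ (s i) = Fintype.card G * c j := by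
    calc _ = ∑ i, c i * ∑ χ : AddChar G ℂ, χ (s i - s j) := by
          simp only [Finset.mul_sum]
          rw [Finset.sum_comm]
          refine Finset.sum_congr rfl fun i _ => Finset.sum_congr rfl fun χ _ => ?_
          rw [sub_eq_add_neg, AddChar.map_add_eq_mul]
          ring
      _ = _ := by
          simp [AddChar.sum_apply_eq_ite, sub_eq_zero, hs.eq_iff, mul_comm]
  simpa [hchar] using hsum.symm

namespace OTFS

variable {nt nr P N M : ℕ} [NeZero N] [NeZero M] {A : Finset ℂ}

theorem rotated_apply (φ : Grid N M → ℂ) (x : Codeword nt N M A) (k : Fin nt) (p : Grid N M) :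
    rotated φ x (k, p) = φ p * x (k, p) := by
  simp [rotated, phaseMatrix, Matrix.mulVec, dotProduct, Fintype.sum_prod_type,
    Matrix.one_apply, Matrix.diagonal_apply]

theorem diffMatrix_apply (S : Paths P N M) (φ : Grid N M → ℂ) (x y : Codeword nt N M A)
    (k : Fin nt) (i : Fin P) (p : Grid N M) :
    diffMatrix S φ x y k i p
      = φ (p - S.shift i) * (x (k, p - S.shift i) - y (k, p - S.shift i)) := by
  simp [diffMatrix, Paths.symbolMatrix, rotated_apply, mul_sub]

/-- A vanishing Fourier coefficient would be a relation between exponentials of the distinct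
algebraic numbers `I * a p`, with algebraic coefficients because character values are roots of
unity. All coefficients would then vanish, forcing `x` and `y` to agree at antenna `k`. -/
theorem linearIndependent_row_diffMatrix (S : Paths P N M) (hAalg : ∀ c ∈ A, IsAlgebraic ℚ c)
    {a : Grid N M → ℝ} (ha : Function.Injective a) (haalg : ∀ p, IsAlgebraic ℚ (a p))
    {φ : Grid N M → ℂ} (hφ : ∀ p, φ p = Complex.exp (Complex.I * a p))
    {x y : Codeword nt N M A} {k : Fin nt} (hxy : (fun p => x (k, p)) ≠ fun p => y (k, p)) :
    LinearIndependent ℂ (diffMatrix S φ x y k).row := by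
  have hrow : (diffMatrix S φ x y k).row
      = fun i p => (fun q => φ q * ((x (k, q) : ℂ) - y (k, q))) (p - S.shift i) := by
    ext i p
    exact diffMatrix_apply S φ x y k i p
  rw [hrow]
  refine linearIndependent_translates (u := fun q => φ q * ((x (k, q) : ℂ) - y (k, q)))
    (s := S.shift) (fun χ hχ => hxy (funext fun p => ?_)) S.distinct
  have h := lindemannWeierstrass (a := fun p => Complex.I * a p)
    (c := fun p => χ p * ((x (k, p) : ℂ) - y (k, p)))
    (fun p q hpq => ha (by simpa using hpq))
    (fun p => (IsIntegral.of_pow (n := 2) two_pos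
      (by rw [Complex.I_sq]; exact isIntegral_one.neg)).isAlgebraic.mul (haalg p).algebraMap)
    (fun p => (χ.isAlgebraic_apply p).mul ((hAalg _ (x (k, p)).2).sub (hAalg _ (y (k, p)).2)))
    (by rw [← hχ]; exact Finset.sum_congr rfl fun p _ => by rw [hφ]; ring) p
  have hχp : χ p ≠ 0 := (AddChar.val_isUnit χ p).ne_zero
  exact Subtype.ext (sub_eq_zero.mp ((mul_eq_zero.mp h).resolve_left hχp))

end OTFS

/-! ### Small-ball and moment estimates for complex Gaussians. -/

section GaussianBounds

theorem gaussianReal_Icc_le {s : ℝ≥0} (hs : s ≠ 0) (a b : ℝ) :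
    gaussianReal 0 s (Set.Icc a b) ≤ ENNReal.ofReal ((√(2 * Real.pi * s))⁻¹ * (b - a)) := by
  rw [gaussianReal_apply 0 hs]
  calc ∫⁻ x in Set.Icc a b, gaussianPDF 0 s x
      ≤ ∫⁻ _ in Set.Icc a b, ENNReal.ofReal (√(2 * Real.pi * s))⁻¹ := by
        refine setLIntegral_mono measurable_const fun x _ => ENNReal.ofReal_le_ofReal ?_
        rw [gaussianPDFReal]
        refine mul_le_of_le_one_right (by positivity) (Real.exp_le_one_iff.mpr ?_)
        exact div_nonpos_of_nonpos_of_nonneg (neg_nonpos.mpr (sq_nonneg _)) (by positivity)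
    _ = _ := by
        rw [setLIntegral_const, Real.volume_Icc, ← ENNReal.ofReal_mul (by positivity)]

theorem exists_le_gaussianReal_Icc {s : ℝ≥0} (hs : s ≠ 0) (R : ℝ) :
    ∃ κ : ℝ, 0 < κ ∧ ∀ a b : ℝ, -R ≤ a → b ≤ R →
      ENNReal.ofReal (κ * (b - a)) ≤ gaussianReal 0 s (Set.Icc a b) := by
  have hs' : (0 : ℝ) < s := by positivity
  set κ := (√(2 * Real.pi * s))⁻¹ * Real.exp (-R ^ 2 / (2 * s))
  have hκ : 0 < κ := by positivity
  refine ⟨κ, hκ, fun a b ha hb => ?_⟩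
  rw [gaussianReal_apply 0 hs]
  calc ENNReal.ofReal (κ * (b - a)) = ∫⁻ _ in Set.Icc a b, ENNReal.ofReal κ := by
        rw [setLIntegral_const, Real.volume_Icc, ← ENNReal.ofReal_mul hκ.le]
    _ ≤ _ := by
        refine setLIntegral_mono (measurable_gaussianPDF 0 s) fun x hx =>
          ENNReal.ofReal_le_ofReal ?_
        rw [gaussianPDFReal, sub_zero]
        have : x ^ 2 ≤ R ^ 2 := sq_le_sq' (by linarith [hx.1]) (by linarith [hx.2])
        refine mul_le_mul_of_nonneg_left (Real.exp_le_exp.mpr ?_) (by positivity)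
        gcongr

end GaussianBounds

namespace OTFS

theorem measurable_complex_mk : Measurable fun z : ℝ × ℝ => (⟨z.1, z.2⟩ : ℂ) :=
  Complex.measurableEquivRealProd.symm.measurable

instance (s : ℝ≥0) : IsProbabilityMeasure (complexGaussian s) :=
  Measure.isProbabilityMeasure_map measurable_complex_mk.aemeasurable

theorem complexGaussian_reProdIm (s : ℝ≥0) (a b c d : ℝ) :
    complexGaussian s {z | z.re ∈ Set.Icc a b ∧ z.im ∈ Set.Icc c d}
      = gaussianReal 0 (s / 2) (Set.Icc a b) * gaussianReal 0 (s / 2) (Set.Icc c d) := by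
  have hmeas : MeasurableSet {z : ℂ | z.re ∈ Set.Icc a b ∧ z.im ∈ Set.Icc c d} :=
    (Complex.measurable_re measurableSet_Icc).inter (Complex.measurable_im measurableSet_Icc)
  rw [complexGaussian, Measure.map_apply measurable_complex_mk hmeas, ← Measure.prod_prod]
  rfl

/-- A disc lies in a square of side `2 * r`, and each real coordinate has bounded density. The
exponent 2 is why each complex gain is worth one unit of diversity. -/
theorem exists_complexGaussian_closedBall_le {s : ℝ≥0} (hs : s ≠ 0) :
    ∃ K : ℝ, 0 ≤ K ∧ ∀ (c : ℂ) (r : ℝ), 0 ≤ r →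
      complexGaussian s (Metric.closedBall c r) ≤ ENNReal.ofReal (K * r ^ 2) := by
  set q := (√(2 * Real.pi * (s / 2 : ℝ≥0)))⁻¹
  have hs2 : s / 2 ≠ 0 := by positivity
  refine ⟨(q * 2) ^ 2, by positivity, fun c r hr => ?_⟩
  calc complexGaussian s (Metric.closedBall c r)
      ≤ complexGaussian s {z | z.re ∈ Set.Icc (c.re - r) (c.re + r) ∧
          z.im ∈ Set.Icc (c.im - r) (c.im + r)} := by
        refine measure_mono fun z hz => ?_
        rw [Metric.mem_closedBall, dist_eq_norm] at hz
        have h1 := (abs_le.mp ((Complex.abs_re_le_norm _).trans hz))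
        have h2 := (abs_le.mp ((Complex.abs_im_le_norm _).trans hz))
        rw [Complex.sub_re] at h1
        rw [Complex.sub_im] at h2
        exact ⟨⟨by linarith, by linarith⟩, ⟨by linarith, by linarith⟩⟩
    _ ≤ ENNReal.ofReal (q * (2 * r)) * ENNReal.ofReal (q * (2 * r)) := by
        rw [complexGaussian_reProdIm]
        refine mul_le_mul' ((gaussianReal_Icc_le hs2 _ _).trans_eq ?_)
          ((gaussianReal_Icc_le hs2 _ _).trans_eq ?_) <;> congr 2 <;> ring
    _ = _ := by
        rw [← ENNReal.ofReal_mul (by positivity)]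
        congr 1; ring

/-- The square of side `r` fits in the disc, and the density is bounded below on bounded sets. -/
theorem exists_le_complexGaussian_closedBall {s : ℝ≥0} (hs : s ≠ 0) (R : ℝ) :
    ∃ κ : ℝ, 0 < κ ∧ ∀ (c : ℂ) (r : ℝ), 0 ≤ r → ‖c‖ + r ≤ R →
      ENNReal.ofReal (κ * r ^ 2) ≤ complexGaussian s (Metric.closedBall c r) := by
  have hs2 : s / 2 ≠ 0 := by positivity
  obtain ⟨κ, hκ, h⟩ := exists_le_gaussianReal_Icc hs2 R
  refine ⟨κ ^ 2, by positivity, fun c r hr hc => ?_⟩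
  have h1 := abs_le.mp (Complex.abs_re_le_norm c)
  have h2 := abs_le.mp (Complex.abs_im_le_norm c)
  calc ENNReal.ofReal (κ ^ 2 * r ^ 2)
      = ENNReal.ofReal (κ * (c.re + r / 2 - (c.re - r / 2)))
        * ENNReal.ofReal (κ * (c.im + r / 2 - (c.im - r / 2))) := by
        rw [← ENNReal.ofReal_mul (by ring_nf; positivity)]
        congr 1; ring
    _ ≤ complexGaussian s {z | z.re ∈ Set.Icc (c.re - r / 2) (c.re + r / 2) ∧
          z.im ∈ Set.Icc (c.im - r / 2) (c.im + r / 2)} := by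
        rw [complexGaussian_reProdIm]
        exact mul_le_mul' (h _ _ (by linarith) (by linarith)) (h _ _ (by linarith) (by linarith))
    _ ≤ complexGaussian s (Metric.closedBall c r) := by
        refine measure_mono fun z ⟨⟨h3, h4⟩, ⟨h5, h6⟩⟩ => ?_
        rw [Metric.mem_closedBall, dist_eq_norm]
        refine (Complex.norm_le_abs_re_add_abs_im _).trans ?_
        rw [Complex.sub_re, Complex.sub_im]
        have h7 : |z.re - c.re| ≤ r / 2 := abs_le.mpr ⟨by linarith, by linarith⟩
        have h8 : |z.im - c.im| ≤ r / 2 := abs_le.mpr ⟨by linarith, by linarith⟩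
        linarith

theorem complexGaussian_eq_map_smul (s : ℝ≥0) :
    complexGaussian s = (complexGaussian 1).map fun z => (√s : ℝ) • z := by
  have hg : gaussianReal 0 (s / 2) = (gaussianReal 0 (1 / 2)).map fun x => √s * x := by
    rw [gaussianReal_map_const_mul, mul_zero]
    congr 1
    ext
    simp [Real.sq_sqrt s.coe_nonneg, div_eq_mul_inv]
  have hm : Measurable fun x : ℝ => √s * x := measurable_const_mul _
  rw [complexGaussian, complexGaussian, hg, Measure.map_prod_map _ _ hm hm,
    Measure.map_map measurable_complex_mk (hm.prodMap hm),
    Measure.map_map (measurable_const_smul _) measurable_complex_mk]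
  congr 1
  ext z
  apply Complex.ext <;> simp

theorem memLp_complexGaussian (s q : ℝ≥0) : MemLp (fun z : ℂ => z) q (complexGaussian s) := by
  rw [complexGaussian]
  refine (memLp_map_measure_iff aestronglyMeasurable_id
    measurable_complex_mk.aemeasurable).mpr ?_
  have hre : MemLp (fun z : ℝ × ℝ => z.1) q
      ((gaussianReal 0 (s / 2)).prod (gaussianReal 0 (s / 2))) :=
    (memLp_id_gaussianReal q).comp_measurePreserving measurePreserving_fst
  have him : MemLp (fun z : ℝ × ℝ => z.2) q
      ((gaussianReal 0 (s / 2)).prod (gaussianReal 0 (s / 2))) :=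
    (memLp_id_gaussianReal q).comp_measurePreserving measurePreserving_snd
  refine (hre.norm.add him.norm).mono measurable_complex_mk.aestronglyMeasurable
    (Eventually.of_forall fun z => ?_)
  rw [Pi.add_apply, Real.norm_of_nonneg (by positivity)]
  exact Complex.norm_le_abs_re_add_abs_im _

theorem lintegral_sum_norm_pow_lt_top {κ : Type*} [Fintype κ] (s : ℝ≥0) (n : ℕ) :
    ∫⁻ v : κ → ℂ, ENNReal.ofReal ((∑ i, ‖v i‖) ^ n) ∂Measure.pi (fun _ => complexGaussian s)
      < ⊤ := by
  rcases Nat.eq_zero_or_pos n with rfl | hn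
  · simp
  have h : MemLp (fun v : κ → ℂ => ∑ i, ‖v i‖) (n : ℝ≥0)
      (Measure.pi fun _ => complexGaussian s) :=
    memLp_finsetSum _ fun i _ => ((memLp_complexGaussian s n).comp_measurePreserving
      (measurePreserving_eval (fun _ : κ => complexGaussian s) i)).norm
  have := lintegral_rpow_enorm_lt_top_of_eLpNorm_lt_top (by simpa using hn.ne') (by simp)
    h.eLpNorm_lt_top
  refine (lintegral_mono fun v => ?_).trans_lt this
  rw [Real.enorm_of_nonneg (Finset.sum_nonneg fun _ _ => norm_nonneg _),
    ENNReal.ofReal_pow (Finset.sum_nonneg fun _ _ => norm_nonneg _)]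
  simp

theorem pi_complexGaussian_eq_map_smul {κ : Type*} [Fintype κ] (s : ℝ≥0) :
    Measure.pi (fun _ : κ => complexGaussian s)
      = (Measure.pi fun _ => complexGaussian 1).map fun v i => (√s : ℝ) • v i := by
  have (i : κ) : SigmaFinite ((complexGaussian 1).map fun z : ℂ => (√s : ℝ) • z) := by
    rw [← complexGaussian_eq_map_smul]; infer_instance
  rw [Measure.pi_map_pi (f := fun (_ : κ) (z : ℂ) => (√s : ℝ) • z)
    (fun _ => (measurable_const_smul _).aemeasurable), ← complexGaussian_eq_map_smul]

/-- The `2n`-th moment of the noise scales as the `n`-th power of its variance; this is the source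
of the power of `1 / γ`. -/
theorem lintegral_sum_norm_pow_eq {κ : Type*} [Fintype κ] (s : ℝ≥0) (n : ℕ) :
    ∫⁻ v : κ → ℂ, ENNReal.ofReal ((∑ i, ‖v i‖) ^ (2 * n)) ∂Measure.pi (fun _ => complexGaussian s)
      = ENNReal.ofReal (s ^ n) * ∫⁻ v : κ → ℂ, ENNReal.ofReal ((∑ i, ‖v i‖) ^ (2 * n))
          ∂Measure.pi (fun _ => complexGaussian 1) := by
  have hmeas : Measurable fun v : κ → ℂ => ENNReal.ofReal ((∑ i, ‖v i‖) ^ (2 * n)) := by fun_prop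
  rw [pi_complexGaussian_eq_map_smul, lintegral_map hmeas (by fun_prop),
    ← lintegral_const_mul _ hmeas]
  refine lintegral_congr fun v => ?_
  rw [← ENNReal.ofReal_mul (by positivity)]
  congr 1
  simp only [norm_smul, ← Finset.mul_sum, mul_pow, Real.norm_of_nonneg (Real.sqrt_nonneg _)]
  rw [pow_mul (√(s : ℝ)), Real.sq_sqrt s.coe_nonneg]

end OTFS

/-- If the linear map `L` is injective on the vectors supported in `p`, then it is small on a
random vector only if all coordinates in `p` are close to values determined by the others. -/
theorem exists_pi_norm_linearMap_le {ι κ : Type*} [Fintype ι] [Fintype κ] {μ : Measure ℂ}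
    [IsProbabilityMeasure μ] {K : ℝ}
    (hμ : ∀ (c : ℂ) (r : ℝ), 0 ≤ r → μ (Metric.closedBall c r) ≤ ENNReal.ofReal (K * r ^ 2))
    (L : (ι → ℂ) →ₗ[ℂ] (κ → ℂ)) (p : ι → Prop) [DecidablePred p]
    (hL : ∀ h, (∀ i, ¬ p i → h i = 0) → L h = 0 → h = 0) :
    ∃ C : ℝ, 0 ≤ C ∧ ∀ t : ℝ, 0 ≤ t → Measure.pi (fun _ => μ) {h | ‖L h‖ ≤ t}
      ≤ ENNReal.ofReal (C * t ^ 2) ^ Fintype.card {i // p i} := by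
  let E : ({i // p i} → ℂ) →ₗ[ℂ] (ι → ℂ) :=
    { toFun := fun x i => if hi : p i then x ⟨i, hi⟩ else 0
      map_add' := fun x y => by ext i; by_cases hi : p i <;> simp [hi]
      map_smul' := fun c x => by ext i; by_cases hi : p i <;> simp [hi] }
  let F (y : {i // ¬ p i} → ℂ) (i : ι) : ℂ := if hi : p i then 0 else y ⟨i, hi⟩
  -- A left inverse recovers the coordinates in `p` from the image, with loss bounded by its
  -- operator norm.
  obtain ⟨g, hg⟩ := (L ∘ₗ E).exists_leftInverse_of_injective (by
    rw [LinearMap.ker_eq_bot']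
    intro x hx
    have := hL (E x) (fun i hi => dif_neg hi) hx
    ext i
    have h := congrFun this i
    simpa [E, i.2] using h)
  set G : (κ → ℂ) →L[ℂ] ({i // p i} → ℂ) := LinearMap.toContinuousLinearMap g
  refine ⟨|K| * ‖G‖ ^ 2, by positivity, fun t ht => ?_⟩
  set e := MeasurableEquiv.piEquivPiSubtypeProd (fun _ : ι => ℂ) p
  have he := (measurePreserving_piEquivPiSubtypeProd (fun _ : ι => μ) p).symm e
  have hsum (x : {i // p i} → ℂ) (y : {i // ¬ p i} → ℂ) : e.symm (x, y) = E x + F y := by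
    ext i
    by_cases hi : p i <;>
      simp [e, E, F, hi, MeasurableEquiv.piEquivPiSubtypeProd, Equiv.piEquivPiSubtypeProd]
  have hLc : Continuous L := L.continuous_of_finiteDimensional
  have hS : MeasurableSet {h | ‖L h‖ ≤ t} := (isClosed_le hLc.norm continuous_const).measurableSet
  rw [← he.measure_preimage hS.nullMeasurableSet,
    Measure.prod_apply_symm (he.measurable hS)]
  refine (lintegral_mono (g := fun _ => ENNReal.ofReal (|K| * ‖G‖ ^ 2 * t ^ 2) ^
    Fintype.card {i // p i}) fun y => ?_).trans (by simp)
  -- For fixed outer coordinates `y`, the vector `x + G (L (F y))` equals `G` applied to a vector of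
  -- norm at most `t`.
  have hsub : (fun x => (x, y)) ⁻¹' (e.symm ⁻¹' {h | ‖L h‖ ≤ t})
      ⊆ Set.univ.pi fun i => Metric.closedBall ((-G (L (F y))) i) (‖G‖ * t) := by
    intro x hx
    rw [← closedBall_pi _ (by positivity), Metric.mem_closedBall, dist_eq_norm, sub_neg_eq_add]
    have h1 : x = G (L (E x)) := (LinearMap.congr_fun hg x).symm
    have h2 : x + G (L (F y)) = G (L (e.symm (x, y))) := by
      rw [hsum, map_add, map_add, ← h1]
    rw [h2]
    exact G.le_opNorm_of_le hx
  refine (measure_mono hsub).trans ?_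
  rw [Measure.pi_pi]
  calc ∏ i, μ (Metric.closedBall ((-G (L (F y))) i) (‖G‖ * t))
      ≤ ∏ _i : {i // p i}, ENNReal.ofReal (|K| * ‖G‖ ^ 2 * t ^ 2) := by
        refine Finset.prod_le_prod' fun i _ => (hμ _ _ (by positivity)).trans ?_
        refine ENNReal.ofReal_le_ofReal ?_
        rw [mul_pow, mul_assoc]
        exact mul_le_mul_of_nonneg_right (le_abs_self K) (by positivity)
    _ = _ := by rw [Finset.prod_const, Finset.card_univ]

/-! ### Pairwise error probability: upper bound. -/

namespace OTFS

variable {nt nr P N M b : ℕ}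

/-- The Doppler phase `e^{-j 2π ν_i τ_i}` of the `i`-th path. -/
noncomputable def Paths.phase (S : Paths P N M) (i : Fin P) : ℂ :=
  Complex.exp (-(2 * Real.pi * (S.doppler i * S.delay i) : ℝ) * Complex.I)

theorem Paths.norm_phase (S : Paths P N M) (i : Fin P) : ‖S.phase i‖ = 1 := by
  rw [phase, ← Complex.ofReal_neg, Complex.norm_exp_ofReal_mul_I]

theorem Paths.phase_ne_zero (S : Paths P N M) (i : Fin P) : S.phase i ≠ 0 := Complex.exp_ne_zero _

variable [NeZero N] [NeZero M] {A : Finset ℂ}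

theorem Paths.mimoMatrix_mulVec_apply (S : Paths P N M) (h : Fin nr × Fin nt × Fin P → ℂ)
    (u : Fin nt × Grid N M → ℂ) (l : Fin nr) (p : Grid N M) :
    (S.mimoMatrix h).mulVec u (l, p)
      = ∑ k, ∑ i, h (l, k, i) * S.phase i * u (k, p - S.shift i) := by
  simp only [Matrix.mulVec, dotProduct, mimoMatrix, channelMatrix, Matrix.of_apply,
    Fintype.sum_prod_type (f := fun q : Fin nt × Grid N M => _), Finset.sum_mul, ite_mul, zero_mul]
  refine Finset.sum_congr rfl fun k _ => ?_
  rw [Finset.sum_comm]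
  refine Finset.sum_congr rfl fun i _ => ?_
  rw [Finset.sum_ite_eq' Finset.univ (p - S.shift i), if_pos (Finset.mem_univ _)]
  rfl

/-- The noiseless received vector as a linear function of the path gains. -/
noncomputable def Paths.mimoLinear (S : Paths P N M) (u : Fin nt × Grid N M → ℂ) :
    (Fin nr × Fin nt × Fin P → ℂ) →ₗ[ℂ] (Fin nr × Grid N M → ℂ) where
  toFun h := (S.mimoMatrix h).mulVec u
  map_add' g h := by
    ext ⟨l, p⟩
    simp [mimoMatrix_mulVec_apply, add_mul, Finset.sum_add_distrib]
  map_smul' c h := by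
    ext ⟨l, p⟩
    simp [mimoMatrix_mulVec_apply, Finset.mul_sum, mul_assoc]

/-- At each receive antenna, vanishing of the output is a linear relation between the rows of `Δ'_k`
with coefficients `h (l, k, i) * S.phase i`. -/
theorem Paths.mimoLinear_injOn (S : Paths P N M) {φ : Grid N M → ℂ} {x z : Codeword nt N M A}
    {k : Fin nt} (hk : LinearIndependent ℂ (diffMatrix S φ x z k).row)
    (h : Fin nr × Fin nt × Fin P → ℂ) (hsupp : ∀ i, ¬ i.2.1 = k → h i = 0)
    (h0 : S.mimoLinear (rotated φ x - rotated φ z) h = 0) : h = 0 := by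
  ext ⟨l, k', i⟩
  by_cases hk' : k' = k
  · subst hk'
    rw [Fintype.linearIndependent_iff] at hk
    have := hk (fun i => h (l, k', i) * S.phase i) ?_ i
    · exact (mul_eq_zero.mp this).resolve_right (S.phase_ne_zero i)
    · ext p
      have h1 := congrFun h0 (l, p)
      rw [mimoLinear, LinearMap.coe_mk, AddHom.coe_mk, mimoMatrix_mulVec_apply,
        Finset.sum_eq_single k' (fun k'' _ hne => Finset.sum_eq_zero fun i _ => by
          rw [hsupp (l, k'', i) hne, zero_mul, zero_mul]) (by simp)] at h1
      simpa [diffMatrix, symbolMatrix] using h1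
  · exact hsupp (l, k', i) hk'

theorem likelihood_eq (S : Paths P N M) (φ : Grid N M → ℂ) (N₀ : ℝ)
    (h : Fin nr × Fin nt × Fin P → ℂ) (y : Fin nr × Grid N M → ℂ) (x : Codeword nt N M A) :
    likelihood S φ N₀ h y x = (Real.pi * N₀)⁻¹ ^ Fintype.card (Fin nr × Grid N M) *
      Real.exp (-(∑ p, ‖y p - (S.mimoMatrix h).mulVec (rotated φ x) p‖ ^ 2) / N₀) := by
  rw [likelihood, Finset.prod_mul_distrib, Finset.prod_const, Finset.card_univ, ← Real.exp_sum]
  simp only [neg_div, Finset.sum_neg_distrib, Finset.sum_div]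

theorem likelihood_le_likelihood_iff (S : Paths P N M) (φ : Grid N M → ℂ) {N₀ : ℝ} (hN₀ : 0 < N₀)
    (h : Fin nr × Fin nt × Fin P → ℂ) (y : Fin nr × Grid N M → ℂ) (x z : Codeword nt N M A) :
    likelihood S φ N₀ h y x ≤ likelihood S φ N₀ h y z ↔
      ∑ p, ‖y p - (S.mimoMatrix h).mulVec (rotated φ z) p‖ ^ 2
        ≤ ∑ p, ‖y p - (S.mimoMatrix h).mulVec (rotated φ x) p‖ ^ 2 := by
  rw [likelihood_eq, likelihood_eq, mul_le_mul_iff_right₀ (by positivity), Real.exp_le_exp,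
    div_le_div_iff_of_pos_right hN₀, neg_le_neg_iff]

theorem received_sub_self (S : Paths P N M) (φ : Grid N M → ℂ)
    (h : Fin nr × Fin nt × Fin P → ℂ) (v : Fin nr × Grid N M → ℂ) (x : Codeword nt N M A)
    (p : Fin nr × Grid N M) :
    received S φ h v x p - (S.mimoMatrix h).mulVec (rotated φ x) p = v p := by
  simp [received]

theorem received_sub_other (S : Paths P N M) (φ : Grid N M → ℂ)
    (h : Fin nr × Fin nt × Fin P → ℂ) (v : Fin nr × Grid N M → ℂ) (x z : Codeword nt N M A)
    (p : Fin nr × Grid N M) :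
    received S φ h v x p - (S.mimoMatrix h).mulVec (rotated φ z) p
      = S.mimoLinear (rotated φ x - rotated φ z) h p + v p := by
  simp only [received, Paths.mimoLinear, LinearMap.coe_mk, AddHom.coe_mk, Matrix.mulVec_sub,
    Pi.add_apply, Pi.sub_apply]
  ring

theorem norm_le_two_mul_sum_norm_of_sum_sq_le {κ : Type*} [Fintype κ] {w v : κ → ℂ}
    (h : ∑ p, ‖w p + v p‖ ^ 2 ≤ ∑ p, ‖v p‖ ^ 2) : ‖w‖ ≤ 2 * ∑ p, ‖v p‖ := by
  have hs : 0 ≤ ∑ p, ‖v p‖ := Finset.sum_nonneg fun _ _ => norm_nonneg _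
  refine (pi_norm_le_iff_of_nonneg (by positivity)).mpr fun q => ?_
  have h1 : ‖w q + v q‖ ^ 2 ≤ (∑ p, ‖v p‖) ^ 2 :=
    ((Finset.single_le_sum (f := fun p => ‖w p + v p‖ ^ 2) (fun _ _ => by positivity)
      (Finset.mem_univ q)).trans h).trans
        (Finset.sum_sq_le_sq_sum_of_nonneg fun _ _ => norm_nonneg _)
  have h2 : ‖w q + v q‖ ≤ ∑ p, ‖v p‖ := le_of_sq_le_sq h1 hs
  have h3 : ‖v q‖ ≤ ∑ p, ‖v p‖ :=
    Finset.single_le_sum (f := fun p => ‖v p‖) (fun _ _ => norm_nonneg _) (Finset.mem_univ q)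
  have h4 : ‖w q‖ ≤ ‖w q + v q‖ + ‖v q‖ := by
    simpa using norm_sub_le (w q + v q) (v q)
  linarith

theorem card_gains_eq (k : Fin nt) :
    Fintype.card {i : Fin nr × Fin nt × Fin P // i.2.1 = k} = P * nr := by
  rw [Fintype.card_congr (β := Fin P × Fin nr)
    { toFun := fun i => (i.1.2.2, i.1.1)
      invFun := fun j => ⟨(j.2, k, j.1), rfl⟩
      left_inv := by rintro ⟨⟨l, k', i⟩, rfl⟩; rfl
      right_inv := fun _ => rfl }]
  simp

instance (γ : ℝ) : IsProbabilityMeasure (law nt nr P N M γ) := by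
  rw [law]; infer_instance

theorem exists_decisionProb_le (hP : 0 < P) (S : Paths P N M) {φ : Grid N M → ℂ}
    {x z : Codeword nt N M A} {k : Fin nt}
    (hk : LinearIndependent ℂ (diffMatrix S φ x z k).row) :
    ∃ C : ℝ, ∀ γ : ℝ, 0 < γ → ∀ D : Detector nt nr P N M A, IsML S φ (1 / γ) D →
      decisionProb S φ D γ x z ≤ C * (1 / γ) ^ (P * nr) := by
  obtain ⟨K, -, hK⟩ := exists_complexGaussian_closedBall_le (s := 1 / (P : ℝ≥0)) (by positivity)
  obtain ⟨C, hC0, hC⟩ := exists_pi_norm_linearMap_le hK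
    (S.mimoLinear (nr := nr) (rotated φ x - rotated φ z)) (fun i => i.2.1 = k)
    (S.mimoLinear_injOn hk)
  rw [card_gains_eq] at hC
  set d := P * nr
  set m := ∫⁻ v : Fin nr × Grid N M → ℂ, ENNReal.ofReal ((∑ i, ‖v i‖) ^ (2 * d))
    ∂Measure.pi (fun _ => complexGaussian 1)
  have hm : m < ⊤ := lintegral_sum_norm_pow_lt_top 1 _
  refine ⟨(4 * C) ^ d * m.toReal, fun γ hγ D hD => ?_⟩
  have hγ' : 0 < 1 / γ := by positivity
  set L := S.mimoLinear (nr := nr) (rotated φ x - rotated φ z)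
  have hLc : Continuous L := L.continuous_of_finiteDimensional
  -- A decision for `z` means `z` is at least as close to the received vector as `x`, so the noise
  -- dominates the difference signal.
  have hsub : {ω | D ω.1 (received S φ ω.1 ω.2 x) = z}
      ⊆ {ω : (Fin nr × Fin nt × Fin P → ℂ) × (Fin nr × Grid N M → ℂ) |
          ‖L ω.1‖ ≤ 2 * ∑ p, ‖ω.2 p‖} := by
    intro ω hω
    have := hD.maximal ω.1 (received S φ ω.1 ω.2 x) x
    rw [show D ω.1 (received S φ ω.1 ω.2 x) = z from hω,
      likelihood_le_likelihood_iff S φ hγ'] at this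
    simp only [received_sub_self, received_sub_other] at this
    exact norm_le_two_mul_sum_norm_of_sum_sq_le this
  have hmeas : MeasurableSet {ω : (Fin nr × Fin nt × Fin P → ℂ) × (Fin nr × Grid N M → ℂ) |
      ‖L ω.1‖ ≤ 2 * ∑ p, ‖ω.2 p‖} :=
    (isClosed_le (hLc.comp continuous_fst).norm (by fun_prop)).measurableSet
  have hbound : law nt nr P N M γ {ω | ‖L ω.1‖ ≤ 2 * ∑ p, ‖ω.2 p‖}
      ≤ ENNReal.ofReal ((4 * C) ^ d) * (ENNReal.ofReal ((1 / γ) ^ d) * m) := by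
    rw [law, Measure.prod_apply_symm hmeas]
    calc _ ≤ ∫⁻ v : Fin nr × Grid N M → ℂ, ENNReal.ofReal ((4 * C) ^ d) *
          ENNReal.ofReal ((∑ i, ‖v i‖) ^ (2 * d))
          ∂Measure.pi (fun _ => complexGaussian (1 / γ).toNNReal) := by
          refine lintegral_mono fun v => ?_
          have hv : 0 ≤ ∑ i, ‖v i‖ := Finset.sum_nonneg fun _ _ => norm_nonneg _
          refine (hC (2 * ∑ i, ‖v i‖) (by positivity)).trans_eq ?_
          rw [← ENNReal.ofReal_pow (by positivity), ← ENNReal.ofReal_mul (by positivity)]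
          congr 1
          rw [pow_mul (∑ i, ‖v i‖), ← mul_pow]
          congr 1
          ring
      _ = _ := by
          rw [lintegral_const_mul _ (by fun_prop), lintegral_sum_norm_pow_eq,
            Real.coe_toNNReal _ hγ'.le]
  rw [decisionProb, Measure.real]
  calc _ ≤ (ENNReal.ofReal ((4 * C) ^ d) * (ENNReal.ofReal ((1 / γ) ^ d) * m)).toReal := by
        refine ENNReal.toReal_mono ?_ ((measure_mono hsub).trans hbound)
        exact ENNReal.mul_ne_top ENNReal.ofReal_ne_top
          (ENNReal.mul_ne_top ENNReal.ofReal_ne_top hm.ne)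
    _ = _ := by
        rw [ENNReal.toReal_mul, ENNReal.toReal_mul, ENNReal.toReal_ofReal (by positivity),
          ENNReal.toReal_ofReal (by positivity)]
        ring

end OTFS

/-! ### Lower bound and passage to the union of all errors. -/

namespace OTFS

variable {nt nr P N M b : ℕ} [NeZero N] [NeZero M] {A : Finset ℂ}

/-- Scaling by `√s` shows that a noise sample lies near `-√s` with a probability bounded below
uniformly in the SNR. -/
theorem complexGaussian_one_le_closedBall (s : ℝ≥0) :
    complexGaussian 1 (Metric.closedBall (-1) (1 / 4))
      ≤ complexGaussian s (Metric.closedBall (-(√s : ℝ) : ℂ) (√s / 4)) := by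
  rw [complexGaussian_eq_map_smul s, Measure.map_apply (measurable_const_smul _)
    measurableSet_closedBall]
  refine measure_mono fun z hz => ?_
  rw [Metric.mem_closedBall, dist_eq_norm, sub_neg_eq_add] at hz
  rw [Set.mem_preimage, Metric.mem_closedBall, dist_eq_norm, sub_neg_eq_add, Complex.real_smul]
  calc ‖((√s : ℝ) : ℂ) * z + (√s : ℝ)‖ = √s * ‖z + 1‖ := by
        rw [← mul_add_one, norm_mul, Complex.norm_real, Real.norm_of_nonneg (Real.sqrt_nonneg _)]
    _ ≤ √s * (1 / 4) := by gcongr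
    _ = _ := by ring

/-- Signal near `σ` and noise near `-σ` nearly cancel: `‖w + v‖ ≤ σ / 2 < 3 * σ / 4 ≤ ‖v‖`. -/
theorem norm_add_lt_of_mem_closedBall {σ : ℝ} (hσ : 0 < σ) {w v : ℂ}
    (hw : ‖w - σ‖ ≤ σ / 4) (hv : ‖v + σ‖ ≤ σ / 4) : ‖w + v‖ < ‖v‖ := by
  have h1 : ‖w + v‖ ≤ ‖w - σ‖ + ‖v + σ‖ := by
    simpa using norm_add_le (w - σ) (v + σ)
  have h2 : ‖(σ : ℂ)‖ ≤ ‖v + σ‖ + ‖v‖ := by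
    simpa using norm_sub_le (v + σ) v
  rw [Complex.norm_real, Real.norm_of_nonneg hσ.le] at h2
  linarith

/-- Paths occupy distinct grid positions, so the echoes of a single symbol do not overlap and each
observation involves one gain. -/
theorem mimoLinear_single_shift (S : Paths P N M) (h : Fin nr × Fin nt × Fin P → ℂ) (k : Fin nt)
    (d : ℂ) (l : Fin nr) (i : Fin P) :
    S.mimoLinear (Pi.single (k, 0) d) h (l, S.shift i) = h (l, k, i) * S.phase i * d := by
  rw [Paths.mimoLinear, LinearMap.coe_mk, AddHom.coe_mk, Paths.mimoMatrix_mulVec_apply,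
    Finset.sum_eq_single k, Finset.sum_eq_single i]
  · simp
  · intro j _ hj
    rw [Pi.single_eq_of_ne, mul_zero]
    intro h0
    exact hj (S.distinct (sub_eq_zero.mp (Prod.ext_iff.mp h0).2)).symm
  · simp
  · intro k' _ hk'
    refine Finset.sum_eq_zero fun j _ => ?_
    rw [Pi.single_eq_of_ne (by simp [hk']), mul_zero]
  · simp

theorem mimoLinear_single_of_notMem_range (S : Paths P N M) (h : Fin nr × Fin nt × Fin P → ℂ)
    (k : Fin nt) (d : ℂ) (l : Fin nr) {p : Grid N M} (hp : p ∉ Set.range S.shift) :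
    S.mimoLinear (Pi.single (k, 0) d) h (l, p) = 0 := by
  rw [Paths.mimoLinear, LinearMap.coe_mk, AddHom.coe_mk, Paths.mimoMatrix_mulVec_apply]
  refine Finset.sum_eq_zero fun k' _ => Finset.sum_eq_zero fun i _ => ?_
  rw [Pi.single_eq_of_ne, mul_zero]
  intro h0
  exact hp ⟨i, (sub_eq_zero.mp (Prod.ext_iff.mp h0).2).symm⟩

theorem real_le_sum_decisionProb (S : Paths P N M) (φ : Grid N M → ℂ)
    (D : Detector nt nr P N M A) (γ : ℝ) (x : Codeword nt N M A)
    {E : Set ((Fin nr × Fin nt × Fin P → ℂ) × (Fin nr × Grid N M → ℂ))}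
    (hE : ∀ ω ∈ E, D ω.1 (received S φ ω.1 ω.2 x) ≠ x) :
    (law nt nr P N M γ).real E ≤ ∑ z, if z = x then 0 else decisionProb S φ D γ x z := by
  have hsub : E ⊆ ⋃ z ∈ Finset.univ.filter (fun z => ¬ z = x),
      {ω | D ω.1 (received S φ ω.1 ω.2 x) = z} := fun ω hω => by
    simpa using hE ω hω
  calc _ ≤ ∑ z with ¬ z = x, decisionProb S φ D γ x z :=
        (measureReal_mono hsub (measure_ne_top _ _)).trans (measureReal_biUnion_finset_le _ _)
    _ = _ := by simp only [Finset.sum_filter, ite_not]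

theorem decisionProb_nonneg (S : Paths P N M) (φ : Grid N M → ℂ) (D : Detector nt nr P N M A)
    (γ : ℝ) (x z : Codeword nt N M A) : 0 ≤ decisionProb S φ D γ x z := measureReal_nonneg

theorem exists_le_codewordErrorRate (hnt : 0 < nt) (hnr : 0 < nr) (hP : 0 < P)
    (S : Paths P N M) (hA : 1 < A.card) {φ : Grid N M → ℂ} (hφ : ∀ p, φ p ≠ 0) :
    ∃ c : ℝ, 0 < c ∧ ∀ γ : ℝ, 1 ≤ γ → ∀ D : Detector nt nr P N M A, IsML S φ (1 / γ) D →
      c * (1 / γ) ^ (P * nr) ≤ codewordErrorRate S φ D γ := by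
  obtain ⟨a₀, ha₀, a₁, ha₁, hne⟩ := Finset.one_lt_card.mp hA
  set k : Fin nt := ⟨0, hnt⟩
  set x : Codeword nt N M A := fun _ => ⟨a₀, ha₀⟩
  set z : Codeword nt N M A := Function.update x (k, 0) ⟨a₁, ha₁⟩
  set d : ℂ := φ 0 * (a₀ - a₁)
  have hd : d ≠ 0 := mul_ne_zero (hφ 0) (sub_ne_zero.mpr hne)
  have hd' : 0 < ‖d‖ := norm_pos_iff.mpr hd
  have hxz : rotated φ x - rotated φ z = Pi.single (k, 0) d := by
    ext ⟨k', p⟩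
    rw [Pi.sub_apply, rotated_apply, rotated_apply]
    by_cases h : (k', p) = (k, 0)
    · obtain ⟨rfl, rfl⟩ := Prod.ext_iff.mp h
      simp [x, z, d, mul_sub]
    · simp [x, z, h]
  -- The discs used below have centre of modulus `σ / ‖d‖` and radius `σ / (4 * ‖d‖)` with `σ ≤ 1`,
  -- so `2 / ‖d‖` suffices.
  obtain ⟨κ, hκ, hκball⟩ := exists_le_complexGaussian_closedBall
    (s := 1 / (P : ℝ≥0)) (by positivity) (2 / ‖d‖)
  obtain ⟨κ₁, hκ₁, hκ₁ball⟩ := exists_le_complexGaussian_closedBall one_ne_zero 2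
  set q := κ₁ * (1 / 4) ^ 2
  have hq : 0 < q := by positivity
  set n := Fintype.card (Fin nr × Grid N M)
  set m := (Fintype.card (Codeword nt N M A) : ℝ)⁻¹
  have hm : 0 < m := inv_pos.mpr (Nat.cast_pos.mpr (Fintype.card_pos_iff.mpr ⟨x⟩))
  refine ⟨m * ((κ / (16 * ‖d‖ ^ 2)) ^ (P * nr) * q ^ n), by positivity, fun γ hγ D hD => ?_⟩
  have hγ0 : 0 < γ := by linarith
  have hγ' : 0 < 1 / γ := by positivity
  set σ : ℝ := √(1 / γ)
  have hσ : 0 < σ := Real.sqrt_pos.mpr hγ'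
  have hσ1 : σ ≤ 1 := Real.sqrt_le_one.mpr ((div_le_one hγ0).mpr hγ)
  -- Each constrained gain brings its echo `h * phase * d` within `σ / 4` of `σ`. Only the `P * nr`
  -- gains of antenna `k` are constrained, each at a cost of order `σ ^ 2 = 1 / γ`.
  let Hset : Set (Fin nr × Fin nt × Fin P → ℂ) := Set.univ.pi fun j =>
    if j.2.1 = k then Metric.closedBall (σ / (S.phase j.2.2 * d)) (σ / (4 * ‖d‖)) else Set.univ
  let Vset : Set (Fin nr × Grid N M → ℂ) :=
    Set.univ.pi fun _ => Metric.closedBall (-σ : ℂ) (σ / 4)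
  have hE : ∀ ω ∈ Hset ×ˢ Vset, D ω.1 (received S φ ω.1 ω.2 x) ≠ x := by
    rintro ⟨h, v⟩ ⟨hh, hv⟩ hDx
    have hv' (p) : ‖v p + σ‖ ≤ σ / 4 := by
      simpa [dist_eq_norm] using hv p (Set.mem_univ p)
    have hw (l : Fin nr) (i : Fin P) : ‖h (l, k, i) * S.phase i * d - σ‖ ≤ σ / 4 := by
      have : h (l, k, i) ∈ if k = k then Metric.closedBall (σ / (S.phase i * d)) (σ / (4 * ‖d‖))
        else Set.univ := hh (l, k, i) (Set.mem_univ _)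
      rw [if_pos rfl, Metric.mem_closedBall, dist_eq_norm] at this
      have hc : h (l, k, i) * S.phase i * d - σ
          = (h (l, k, i) - σ / (S.phase i * d)) * (S.phase i * d) := by
        have := S.phase_ne_zero i
        field_simp
      rw [hc, norm_mul, norm_mul, S.norm_phase, one_mul]
      calc _ ≤ σ / (4 * ‖d‖) * ‖d‖ := by gcongr
        _ = σ / 4 := by field_simp
    have hlt (l : Fin nr) (i : Fin P) : ‖S.mimoLinear (rotated φ x - rotated φ z) h (l, S.shift i)
        + v (l, S.shift i)‖ < ‖v (l, S.shift i)‖ := by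
      rw [hxz, mimoLinear_single_shift]
      exact norm_add_lt_of_mem_closedBall hσ (hw l i) (hv' _)
    have hle (p) : ‖S.mimoLinear (rotated φ x - rotated φ z) h p + v p‖ ≤ ‖v p‖ := by
      obtain ⟨l, p⟩ := p
      by_cases hp : p ∈ Set.range S.shift
      · obtain ⟨i, rfl⟩ := hp
        exact (hlt l i).le
      · rw [hxz, mimoLinear_single_of_notMem_range S h k d l hp, zero_add]
    have hmax := hD.maximal h (received S φ h v x) z
    rw [show D h (received S φ h v x) = x from hDx, likelihood_le_likelihood_iff S φ hγ'] at hmax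
    simp only [received_sub_self, received_sub_other] at hmax
    -- Strict inequality at one echo position excludes ties, so `z` beats `x` however ties are
    -- broken.
    refine absurd hmax (not_le.mpr (Finset.sum_lt_sum (fun p _ => by gcongr; exact hle p)
      ⟨(⟨0, hnr⟩, S.shift ⟨0, hP⟩), Finset.mem_univ _, ?_⟩))
    gcongr
    exact hlt _ _
  have hH : ENNReal.ofReal (κ / (16 * ‖d‖ ^ 2) * (1 / γ)) ^ (P * nr)
      ≤ Measure.pi (fun _ => complexGaussian (1 / (P : ℝ≥0))) Hset := by
    rw [Measure.pi_pi, ← card_gains_eq k, Fintype.card_subtype, ← Finset.prod_const,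
      Finset.prod_filter]
    refine Finset.prod_le_prod' fun j _ => ?_
    by_cases hj : j.2.1 = k
    · rw [if_pos hj, if_pos hj]
      refine le_trans (ENNReal.ofReal_le_ofReal (le_of_eq ?_))
        (hκball _ (σ / (4 * ‖d‖)) (by positivity) ?_)
      · rw [div_pow, Real.sq_sqrt hγ'.le]
        ring
      · rw [norm_div, norm_mul, S.norm_phase, one_mul, Complex.norm_real,
          Real.norm_of_nonneg hσ.le]
        have : σ / ‖d‖ + σ / (4 * ‖d‖) = (5 / 4 * σ) / ‖d‖ := by field_simp; ring
        rw [this]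
        gcongr
        linarith
    · rw [if_neg hj, if_neg hj, measure_univ]
  have hV : ENNReal.ofReal q ^ n
      ≤ Measure.pi (fun _ => complexGaussian (1 / γ).toNNReal) Vset := by
    rw [Measure.pi_pi, show n = Finset.card Finset.univ from Finset.card_univ.symm,
      ← Finset.prod_const]
    refine Finset.prod_le_prod' fun _ _ => ?_
    refine (hκ₁ball (-1) (1 / 4) (by norm_num) (by norm_num)).trans
      ((complexGaussian_one_le_closedBall (1 / γ).toNNReal).trans_eq ?_)
    rw [Real.coe_toNNReal _ hγ'.le]
  have hlaw : (κ / (16 * ‖d‖ ^ 2) * (1 / γ)) ^ (P * nr) * q ^ n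
      ≤ (law nt nr P N M γ).real (Hset ×ˢ Vset) := by
    rw [Measure.real, ← ENNReal.ofReal_le_iff_le_toReal (measure_ne_top _ _), law,
      Measure.prod_prod, ENNReal.ofReal_mul (by positivity), ENNReal.ofReal_pow (by positivity),
      ENNReal.ofReal_pow hq.le]
    exact mul_le_mul' hH hV
  calc _ = m * ((κ / (16 * ‖d‖ ^ 2) * (1 / γ)) ^ (P * nr) * q ^ n) := by
        rw [mul_pow (κ / (16 * ‖d‖ ^ 2))]; ring
    _ ≤ m * ∑ z, if z = x then 0 else decisionProb S φ D γ x z := by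
        gcongr
        exact hlaw.trans (real_le_sum_decisionProb S φ D γ x hE)
    _ ≤ codewordErrorRate S φ D γ := by
        rw [codewordErrorRate]
        refine mul_le_mul_of_nonneg_left ?_ hm.le
        refine Finset.single_le_sum
          (f := fun x => ∑ z, if z = x then 0 else decisionProb S φ D γ x z)
          (fun x' _ => Finset.sum_nonneg fun z _ => ?_) (Finset.mem_univ x)
        split_ifs
        exacts [le_rfl, decisionProb_nonneg ..]

theorem exists_codewordErrorRate_le (hP : 0 < P) (S : Paths P N M) {φ : Grid N M → ℂ}
    (hrank : ∀ (x z : Codeword nt N M A) (k : Fin nt),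
      (fun p => x (k, p)) ≠ (fun p => z (k, p)) → LinearIndependent ℂ (diffMatrix S φ x z k).row) :
    ∃ C : ℝ, ∀ γ : ℝ, 0 < γ → ∀ D : Detector nt nr P N M A, IsML S φ (1 / γ) D →
      codewordErrorRate S φ D γ ≤ C * (1 / γ) ^ (P * nr) := by
  have h (x z : Codeword nt N M A) : ∃ C : ℝ, z ≠ x → ∀ γ : ℝ, 0 < γ →
      ∀ D : Detector nt nr P N M A, IsML S φ (1 / γ) D →
        decisionProb S φ D γ x z ≤ C * (1 / γ) ^ (P * nr) := by
    by_cases hxz : z = x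
    · exact ⟨0, fun h => absurd hxz h⟩
    · obtain ⟨⟨k, p⟩, hkp⟩ := Function.ne_iff.mp hxz
      obtain ⟨C, hC⟩ := exists_decisionProb_le (nr := nr) hP S
        (hrank x z k fun h => hkp (congrFun h p).symm)
      exact ⟨C, fun _ => hC⟩
  choose C hC using h
  refine ⟨(Fintype.card (Codeword nt N M A) : ℝ)⁻¹ * ∑ x, ∑ z, if z = x then 0 else C x z,
    fun γ hγ D hD => ?_⟩
  rw [codewordErrorRate, mul_assoc]
  refine mul_le_mul_of_nonneg_left ?_ (by positivity)
  simp only [Finset.sum_mul]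
  refine Finset.sum_le_sum fun x _ => Finset.sum_le_sum fun z _ => ?_
  split_ifs with hzx
  · rw [zero_mul]
  · exact hC x z hzx γ hγ D hD

/-! ### Bit error rate and extraction of the exponent. -/

theorem bitErrors_self (bits : A → Fin b → Bool) (x : Codeword nt N M A) :
    bitErrors bits x x = 0 := by
  simp [bitErrors]

theorem one_le_bitErrors {bits : A → Fin b → Bool} (hbits : Function.Injective bits)
    {x z : Codeword nt N M A} (hxz : z ≠ x) : 1 ≤ bitErrors bits x z := by
  obtain ⟨p, hp⟩ := Function.ne_iff.mp hxz
  refine le_trans ?_ (Finset.single_le_sum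
    (f := fun p => hammingDist (bits (x p)) (bits (z p))) (fun _ _ => Nat.zero_le _)
    (Finset.mem_univ p))
  exact hammingDist_pos.mpr fun h => hp (hbits h).symm

theorem bitErrors_le (bits : A → Fin b → Bool) (x z : Codeword nt N M A) :
    bitErrors bits x z ≤ b * nt * M * N := by
  calc bitErrors bits x z ≤ ∑ _p : Fin nt × Grid N M, b :=
        Finset.sum_le_sum fun p _ => by
          simpa using hammingDist_le_card_fintype (x := bits (x p)) (y := bits (z p))
    _ = _ := by simp [ZMod.card]; ring

theorem bitErrorRate_le (S : Paths P N M) (φ : Grid N M → ℂ) (bits : A → Fin b → Bool)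
    (D : Detector nt nr P N M A) (γ : ℝ) :
    bitErrorRate S φ bits D γ ≤ codewordErrorRate S φ D γ := by
  rw [bitErrorRate, codewordErrorRate]
  refine mul_le_mul_of_nonneg_left ?_ (by positivity)
  refine Finset.sum_le_sum fun x _ => Finset.sum_le_sum fun z _ => ?_
  split_ifs with hzx
  · simp [hzx, bitErrors_self]
  · refine mul_le_of_le_one_left (decisionProb_nonneg ..) (div_le_one_of_le₀ ?_ (by positivity))
    exact_mod_cast bitErrors_le bits x z

theorem le_bitErrorRate (S : Paths P N M) (φ : Grid N M → ℂ) {bits : A → Fin b → Bool}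
    (hbits : Function.Injective bits) (D : Detector nt nr P N M A) (γ : ℝ) :
    (b * nt * M * N : ℝ)⁻¹ * codewordErrorRate S φ D γ ≤ bitErrorRate S φ bits D γ := by
  rw [bitErrorRate, codewordErrorRate, mul_left_comm]
  refine mul_le_mul_of_nonneg_left ?_ (by positivity)
  simp only [Finset.mul_sum]
  refine Finset.sum_le_sum fun x _ => Finset.sum_le_sum fun z _ => ?_
  split_ifs with hzx
  · simp [hzx, bitErrors_self]
  · refine mul_le_mul_of_nonneg_right ?_ (decisionProb_nonneg ..)
    rw [div_eq_mul_inv]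
    refine le_mul_of_one_le_left (by positivity) ?_
    exact_mod_cast one_le_bitErrors hbits hzx

/-- Constant factors contribute `log a / log γ`, which tends to 0. -/
theorem hasDiversityOrder_of_bounds {p : ℝ → ℝ} {n : ℕ} {c C : ℝ} (hc : 0 < c)
    (hle : ∀ γ : ℝ, 1 ≤ γ → c * (1 / γ) ^ n ≤ p γ) (hge : ∀ γ : ℝ, 1 ≤ γ → p γ ≤ C * (1 / γ) ^ n) :
    HasDiversityOrder p n := by
  -- Comparing both bounds at `γ = 1` gives `c ≤ C`.
  have hC : 0 < C := by
    have h1 := (hle 1 le_rfl).trans (hge 1 le_rfl)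
    simp only [div_one, one_pow, mul_one] at h1
    linarith
  have hlim (a : ℝ) : Tendsto (fun γ => (n : ℝ) - Real.log a / Real.log γ) atTop (𝓝 n) := by
    simpa using tendsto_const_nhds.sub (Real.tendsto_log_atTop.const_div_atTop (Real.log a))
  have hlog {a γ : ℝ} (ha : 0 < a) (hγ : 1 < γ) :
      -Real.log (a * (1 / γ) ^ n) / Real.log γ = n - Real.log a / Real.log γ := by
    have : Real.log γ ≠ 0 := (Real.log_pos hγ).ne'
    rw [Real.log_mul ha.ne' (by positivity), Real.log_pow, one_div, Real.log_inv]
    field_simp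
    ring
  refine tendsto_of_tendsto_of_tendsto_of_le_of_le' (hlim C) (hlim c) ?_ ?_
  · filter_upwards [eventually_gt_atTop 1] with γ hγ
    rw [← hlog hC hγ]
    have hpos : 0 < p γ := lt_of_lt_of_le (by positivity) (hle γ hγ.le)
    exact div_le_div_of_nonneg_right (neg_le_neg (Real.log_le_log hpos (hge γ hγ.le)))
      (Real.log_pos hγ).le
  · filter_upwards [eventually_gt_atTop 1] with γ hγ
    rw [← hlog hc hγ]
    exact div_le_div_of_nonneg_right
      (neg_le_neg (Real.log_le_log (by positivity) (hle γ hγ.le))) (Real.log_pos hγ).le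

end OTFS

theorem mainTheorem3 {nt nr P N M b : ℕ} [NeZero N] [NeZero M]
    (hnt : 0 < nt) (hnr : 0 < nr) (hP : 0 < P)
    -- the propagation paths
    (S : OTFS.Paths P N M)
    -- the modulation alphabet, with a labelling of its points by bits
    (A : Finset ℂ) (hA : 1 < A.card) (hAalg : ∀ c ∈ A, IsAlgebraic ℚ c)
    (bits : A → Fin b → Bool) (hbits : Function.Injective bits)
    -- the phase rotation matrix
    (a : OTFS.Grid N M → ℝ) (ha : Function.Injective a) (haalg : ∀ p, IsAlgebraic ℚ (a p))
    (φ : OTFS.Grid N M → ℂ) (hφ : ∀ p, φ p = Complex.exp (Complex.I * a p))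
    (hφtr : ∀ p, Transcendental ℚ (φ p))
    -- at every SNR, a maximum likelihood detector
    (D : ℝ → OTFS.Detector nt nr P N M A)
    (hD : ∀ γ : ℝ, 0 < γ → OTFS.IsML S φ (1 / γ) (D γ)) :
    -- the error probabilities have diversity order `P * nr`
    OTFS.HasDiversityOrder (fun γ => OTFS.codewordErrorRate S φ (D γ) γ) (P * nr) ∧
    OTFS.HasDiversityOrder (fun γ => OTFS.bitErrorRate S φ bits (D γ) γ) (P * nr) ∧
    -- and `P * nr` is `nr` times the minimal rank of a difference matrix
    IsLeast {r : ℕ | ∃ (x y : OTFS.Codeword nt N M A) (k : Fin nt),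
      (fun p => x (k, p)) ≠ (fun p => y (k, p)) ∧
        r = nr * (OTFS.diffMatrix S φ x y k).rank} (P * nr) := by
  have hli (x z : OTFS.Codeword nt N M A) (k : Fin nt)
      (hxz : (fun p => x (k, p)) ≠ fun p => z (k, p)) :
      LinearIndependent ℂ (OTFS.diffMatrix S φ x z k).row :=
    OTFS.linearIndependent_row_diffMatrix S hAalg ha haalg hφ hxz
  have hrank (x z : OTFS.Codeword nt N M A) (k : Fin nt)
      (hxz : (fun p => x (k, p)) ≠ fun p => z (k, p)) : (OTFS.diffMatrix S φ x z k).rank = P := by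
    rw [(hli x z k hxz).rank_matrix, Fintype.card_fin]
  obtain ⟨c, hc, hlow⟩ := OTFS.exists_le_codewordErrorRate hnt hnr hP S hA (φ := φ)
    (fun p => by rw [hφ]; exact Complex.exp_ne_zero _)
  obtain ⟨C, hup⟩ := OTFS.exists_codewordErrorRate_le (nr := nr) hP S hli
  obtain ⟨a₀, ha₀, a₁, ha₁, hne⟩ := Finset.one_lt_card.mp hA
  have hlow' (γ : ℝ) (hγ : 1 ≤ γ) := hlow γ hγ (D γ) (hD γ (by linarith))
  have hup' (γ : ℝ) (hγ : 1 ≤ γ) := hup γ (by linarith) (D γ) (hD γ (by linarith))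
  -- With no bits all labels coincide, contradicting injectivity on two symbols.
  have hb : 0 < b := by
    rw [Nat.pos_iff_ne_zero]
    rintro rfl
    exact hne (congrArg Subtype.val
      (hbits (Subsingleton.elim (bits ⟨a₀, ha₀⟩) (bits ⟨a₁, ha₁⟩))))
  have hN : 0 < N := Nat.pos_of_neZero N
  have hM : 0 < M := Nat.pos_of_neZero M
  refine ⟨?_, ?_, ?_, ?_⟩
  · exact_mod_cast OTFS.hasDiversityOrder_of_bounds hc hlow' hup'
  · rw [← Nat.cast_mul]
    refine OTFS.hasDiversityOrder_of_bounds (c := (b * nt * M * N : ℝ)⁻¹ * c) (C := C)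
      (by positivity) (fun γ hγ => ?_) (fun γ hγ => ?_)
    · rw [mul_assoc]
      exact (mul_le_mul_of_nonneg_left (hlow' γ hγ) (by positivity)).trans
        (OTFS.le_bitErrorRate S φ hbits (D γ) γ)
    · exact (OTFS.bitErrorRate_le S φ bits (D γ) γ).trans (hup' γ hγ)
  · let x (c : A) : OTFS.Codeword nt N M A := fun _ => c
    have hxy : (fun p => x ⟨a₀, ha₀⟩ (⟨0, hnt⟩, p)) ≠ fun p => x ⟨a₁, ha₁⟩ (⟨0, hnt⟩, p) :=
      fun h => hne (congrArg Subtype.val (congrFun h 0))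
    exact ⟨x ⟨a₀, ha₀⟩, x ⟨a₁, ha₁⟩, ⟨0, hnt⟩, hxy, by rw [hrank _ _ _ hxy, mul_comm]⟩
  · rintro r ⟨x, y, k, hxy, rfl⟩
    rw [hrank x y k hxy, mul_comm]
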